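/- Let $K$ be an algebraically closed field (e.g. $K=\mathbb{C}$), let $n\ge 4$, and let $P_1,\dots,P_n$ and $Q_1,\dots,Q_n$ be two $n$-tuples of linear projections $\mathbb{P}^k\dashrightarrow\mathbb{P}^{h_j}$ ($j=1,\dots,n$), each identified with an $(h_j+1)\times(k+1)$ matrix over $K$ of rank $h_j+1$. A profile is an $n$-tuple of integers $(\alpha_1,\dots,\alpha_n)$ with $0\le\alpha_j\le h_j$ and $\sum_j\alpha_j=k+1$. For matrices $S_j$ of type $(h_j+1)\times(h_j-\alpha_j+1)$ let $$T^{P_1,\dots,P_n}_{S_1,\dots,S_n}=\begin{pmatrix}P_1&S_1&0&\cdots&0\\P_2&0&S_2&\cdots&0\\ \vdots&&&\ddots&\vdots\\P_n&0&0&\cdots&S_n\end{pmatrix},$$ a square matrix. The critical locus $\mathcal{X}\subseteq\mathbb{P}^k=\operatorname{Proj}K[x_0,\dots,x_k]$ of the two $n$-tuples is the closed subscheme whose ideal is generated by the polynomials $\det T^{P_1,\dots,P_n}_{S_1,\dots,S_n}$ with $S_j=(\,Q_j(\mathbf{X})\mid S'_j\,)$, $\mathbf{X}=(x_0,\dots,x_k)^{T}$,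 for all profiles and all constant $(h_j+1)\times(h_j-\alpha_j)$ matrices $S'_j$; equivalently, by the maximal minors of the $(n+\sum_j h_j)\times(n+k+1)$ matrix $$\begin{pmatrix}P_1&Q_1(\mathbf{X})&0&\cdots&0\\P_2&0&Q_2(\mathbf{X})&\cdots&0\\ \vdots&&&\ddots&\vdots\\P_n&0&0&\cdots&Q_n(\mathbf{X})\end{pmatrix}.$$ Suppose that $\mathcal{X}$ has codimension $c\ge 2$ in $\mathbb{P}^k$ and that this is the expected codimension, i.e. $\dim\mathcal{X}=k-c=2k-\sum_{j}h_j$. Then $\mathcal{X}$ is not irreducible or $\mathcal{X}$ is singular, i.e. it has a point at which the rank of the Jacobian matrix of its ideal is smaller than its local codimension in $\mathbb{P}^k$. -/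

import Mathlib

open MvPolynomial

noncomputable section

namespace CriticalLocus

attribute [local instance] MvPolynomial.gradedAlgebra

variable {K : Type*} [Field K] {k n : ℕ} {h : Fin n → ℕ}

/-- A linear projection `ℙ^k ⇢ ℙ^h`, in homogeneous coordinates: an `(h+1) × (k+1)` matrix of
maximal rank `h + 1`. Its center is the projectivization of its right annihilator. -/
def IsProjection {m : ℕ} (A : Matrix (Fin (m + 1)) (Fin (k + 1)) K) : Prop :=
  A.rank = m + 1

/-- The coefficient matrix `T^{P_1,…,P_n}_{S_1,…,S_n}` of the linear system
`P_j Y + S_j v_j = 0` (`j = 1,…,n`) in the unknowns `Y, v_1, …, v_n`: the first block of columns is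
the stack of all the `P_j`, the other columns are the block diagonal matrix of the `S_j`. -/
def grassmannMatrix {R : Type*} [CommRing R] {s : Fin n → ℕ}
    (P : ∀ j, Matrix (Fin (h j + 1)) (Fin (k + 1)) R)
    (S : ∀ j, Matrix (Fin (h j + 1)) (Fin (s j)) R) :
    Matrix (Σ j, Fin (h j + 1)) (Fin (k + 1) ⊕ (Σ j, Fin (s j))) R :=
  Matrix.fromCols (Matrix.of fun r i => P r.1 r.2 i) (Matrix.blockDiagonal' S)

/-- The vector of linear forms `Q(X)`, with `X = (x_0, …, x_k)` the generic point of `ℙ^k`. -/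
def linearForms {m : ℕ} (Q : Matrix (Fin (m + 1)) (Fin (k + 1)) K) (r : Fin (m + 1)) :
    MvPolynomial (Fin (k + 1)) K :=
  ∑ i, C (Q r i) * X i

/-- The matrix `(Q(X) | S')`, whose columns span a linear subspace `L` of the view that passes
through the image `Q(X)`; the first column consists of linear forms, the others are constant. -/
def spanningMatrix {m s : ℕ} (Q : Matrix (Fin (m + 1)) (Fin (k + 1)) K)
    (S' : Matrix (Fin (m + 1)) (Fin s) K) :
    Matrix (Fin (m + 1)) (Fin (s + 1)) (MvPolynomial (Fin (k + 1)) K) :=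
  Matrix.of fun r => Fin.cons (linearForms Q r) fun l => C (S' r l)

/-- The homogeneous ideal of the critical locus of two `n`-tuples of projections: it is generated
by the values `det T^{P_1,…,P_n}_{S_1,…,S_n}` of the Grassmann tensor of `P_1, …, P_n`, for all
profiles `(α_1, …, α_n)` (that is `0 ≤ α_j ≤ h_j`, `∑ α_j = k + 1`), on all the `n`-tuples of
linear subspaces `L_j ∋ Q_j(X)` of codimension `α_j`. For a profile, `T` is square; a bijection `e`
between row and column indices orders them and affects the determinant by a sign only. -/
def criticalIdeal (P Q : ∀ j, Matrix (Fin (h j + 1)) (Fin (k + 1)) K) :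
    Ideal (MvPolynomial (Fin (k + 1)) K) :=
  Ideal.span {f | ∃ α : Fin n → ℕ, (∀ j, α j ≤ h j) ∧ ∑ j, α j = k + 1 ∧
    ∃ (S' : ∀ j, Matrix (Fin (h j + 1)) (Fin (h j - α j)) K)
      (e : (Σ j, Fin (h j + 1)) ≃ (Fin (k + 1) ⊕ (Σ j, Fin (h j - α j + 1)))),
      f = ((grassmannMatrix (fun j => (P j).map C)
        (fun j => spanningMatrix (Q j) (S' j))).submatrix id e).det}

/-- Projective space `ℙ^k = Proj K[x_0, …, x_k]`, as a topological space. -/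
abbrev ProjSpace (K : Type*) [Field K] (k : ℕ) : Type _ :=
  ProjectiveSpectrum (homogeneousSubmodule (Fin (k + 1)) K)

/-- The critical locus as a closed subset of `ℙ^k`. Its scheme structure is the one given by
`criticalIdeal P Q`. -/
def criticalLocus (P Q : ∀ j, Matrix (Fin (h j + 1)) (Fin (k + 1)) K) : Set (ProjSpace K k) :=
  ProjectiveSpectrum.zeroLocus (homogeneousSubmodule (Fin (k + 1)) K) (criticalIdeal P Q)

/-- The rank at `v` of the Jacobian matrix of a system of generators of the ideal `I`, for a zero
`v` of `I`: the dimension of the space spanned by the gradients at `v` of the elements of `I`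
(those of the generators suffice). -/
def jacobianRank (I : Ideal (MvPolynomial (Fin (k + 1)) K)) (v : Fin (k + 1) → K) : ℕ :=
  Module.finrank K
    (Submodule.span K {w : Fin (k + 1) → K | ∃ f ∈ I, w = fun i => eval v (pderiv i f)})

/-- The local dimension at `v` of the affine cone `Spec K[x_0, …, x_k]/I`: the height of the maximal
ideal of the point `v`. If `I` is homogeneous and `v ≠ 0`, it equals `1 + dim_x X`, where
`X = Proj K[x_0, …, x_k]/I` and `x = [v]`. -/
def coneLocalDim (I : Ideal (MvPolynomial (Fin (k + 1)) K)) (v : Fin (k + 1) → K) : ℕ∞ :=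
  ((RingHom.ker (eval v)).map (Ideal.Quotient.mk I)).height

/-- The point `[v]` of `ℙ^k` is a singular point of the closed subscheme defined by the homogeneous
ideal `I` (`K` algebraically closed), by the Jacobian criterion: `[v]` lies on the subscheme `X`, and
the Jacobian matrix there has rank less than the local codimension `k - dim_x X` of `X`. -/
def IsSingularPoint (I : Ideal (MvPolynomial (Fin (k + 1)) K)) (v : Fin (k + 1) → K) : Prop :=
  v ≠ 0 ∧ (∀ f ∈ I, eval v f = 0) ∧ (jacobianRank I v : ℕ∞) + coneLocalDim I v < (k + 1 : ℕ)

end CriticalLocus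

end

/-! Suppose the locus is irreducible without singular points. Over the center of `Q j` a column of
every generating determinant vanishes, so each nonempty center lies in the locus. At a point common
to two centers, two columns vanish, so all generators lie in the square of its maximal ideal and the
point is singular (`criticalIdeal_le_sq`, `isSingularPoint_of_le_sq`). Hence the centers are
pairwise disjoint, which forces h_i + h_j ≥ k - 1. A center of dimension at least k - c would fill
the irreducible locus (`linearPoint_le_of_finrank`); the other centers would be empty and ∑ h_j too
large. Hence h_j ≥ c for all j. With two disjoint pairs of indices, k + c = ∑ h_j is at least 2(k -
1) and at least 4c, so 3c ≤ k ≤ c + 2, against c ≥ 2. -/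

noncomputable section
namespace CriticalLocus
attribute [local instance] MvPolynomial.gradedAlgebra

/-! ### Vanishing ideals of linear subspaces. -/

section LinearSubspaces

variable {K σ : Type*} [Field K]

lemma vanishingIdeal_isHomogeneous [Infinite K] (W : Submodule K (σ → K)) :
    (vanishingIdeal K (W : Set (σ → K))).IsHomogeneous (homogeneousSubmodule σ K) := by
  intro d f hf
  rw [mem_vanishingIdeal_iff] at hf ⊢
  intro w hw
  change aeval w (decomposition.decompose' f d : MvPolynomial σ K) = 0
  rw [decomposition.decompose'_apply]
  -- `F` is t ↦ f(t w): its coefficients are the values at w of the homogeneous components of f, and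
  -- it is zero because K is infinite.
  set F : Polynomial K := ∑ i ∈ Finset.range (f.totalDegree + 1),
    Polynomial.C (eval w (homogeneousComponent i f)) * Polynomial.X ^ i with hF
  have hF0 : F = 0 := by
    refine Polynomial.funext fun t => ?_
    have h1 := hf (t • w) (W.smul_mem t hw)
    rw [← sum_homogeneousComponent f, map_sum] at h1
    rw [hF, Polynomial.eval_finsetSum, Polynomial.eval_zero, ← h1]
    refine Finset.sum_congr rfl fun i _ => ?_
    have h2 := (homogeneousComponent_isHomogeneous i f)
    simp only [Polynomial.eval_mul, Polynomial.eval_C, Polynomial.eval_pow, Polynomial.eval_X]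
    rw [aeval_eq_eval, eval_eq, eval_eq, Finset.sum_mul]
    refine Finset.sum_congr rfl fun m hm => ?_
    have h3 : m.degree = i := by
      rw [Finsupp.degree_eq_weight_one]
      exact h2 (mem_support_iff.1 hm)
    simp only [Pi.smul_apply, smul_eq_mul, mul_pow, Finset.prod_mul_distrib]
    rw [Finset.prod_pow_eq_pow_sum, ← Finsupp.degree_apply, h3]
    ring
  by_cases hd : d ∈ Finset.range (f.totalDegree + 1)
  · have := congrArg (fun p : Polynomial K => p.coeff d) hF0
    simp only [hF, Polynomial.finsetSum_coeff, Polynomial.coeff_C_mul, Polynomial.coeff_X_pow,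
      Polynomial.coeff_zero, mul_ite, mul_one, mul_zero] at this
    rw [Finset.sum_ite_eq, if_pos hd] at this
    exact this
  · rw [homogeneousComponent_eq_zero, map_zero]
    simpa using hd

lemma vanishingIdeal_isPrime [Infinite K] (W : Submodule K (σ → K)) :
    (vanishingIdeal K (W : Set (σ → K))).IsPrime := by
  refine ⟨fun h => ?_, fun {f g} hfg => ?_⟩
  · have h1 : (1 : MvPolynomial σ K) ∈ vanishingIdeal K (W : Set (σ → K)) := h ▸ trivial
    simpa using h1 0 W.zero_mem
  by_contra! hne
  simp only [mem_vanishingIdeal_iff, not_forall] at hne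
  obtain ⟨⟨a, ha, hfa⟩, b, hb, hgb⟩ := hne
  -- Restriction to the line through a (at t = 0) and b (at t = 1), which lies in W.
  let φ : MvPolynomial σ K →ₐ[K] Polynomial K :=
    aeval fun i => Polynomial.C (a i) + Polynomial.X * Polynomial.C (b i - a i)
  have hφ : ∀ (p : MvPolynomial σ K) (t : K),
      (φ p).eval t = aeval (a + t • (b - a)) p := by
    intro p t
    rw [← Polynomial.coe_aeval_eq_eval, ← AlgHom.comp_apply]
    congr 1
    ext i
    simp [φ]
  have h0 : φ f * φ g = 0 := by
    refine Polynomial.funext fun t => ?_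
    rw [← map_mul, hφ, Polynomial.eval_zero]
    exact hfg _ (W.add_mem ha (W.smul_mem t (W.sub_mem hb ha)))
  rcases mul_eq_zero.1 h0 with h | h
  · apply hfa
    have := hφ f 0
    simpa [h] using this.symm
  · apply hgb
    have := hφ g 1
    simpa [h] using this.symm

lemma vanishingIdeal_le_iff [Finite σ] {W W' : Submodule K (σ → K)} :
    vanishingIdeal K (W : Set (σ → K)) ≤ vanishingIdeal K (W' : Set (σ → K)) ↔ W' ≤ W := by
  classical
  have := Fintype.ofFinite σ
  refine ⟨fun h w hw => ?_, fun h => vanishingIdeal_anti_mono h⟩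
  by_contra hwW
  -- A linear form separates w from W; it is then written as a polynomial of degree one.
  obtain ⟨φ, hφ, hWφ⟩ := Submodule.exists_le_ker_of_notMem hwW
  have key : ∀ x : σ → K, aeval x (∑ i, C (φ fun j => if i = j then 1 else 0) * X i :
      MvPolynomial σ K) = φ x := by
    intro x
    rw [LinearMap.pi_apply_eq_sum_univ φ x]
    simp [mul_comm]
  apply hφ
  rw [← key w]
  refine h (fun x hx => ?_) w hw
  rw [key x]
  exact hWφ hx

lemma exists_le_finrank_eq {V : Type*} [AddCommGroup V] [Module K V] (W : Submodule K V) {m : ℕ}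
    (hm : m ≤ Module.finrank K W) : ∃ W' ≤ W, Module.finrank K W' = m := by
  obtain ⟨v, hv⟩ := exists_linearIndependent_of_le_finrank hm
  have hv' := hv.map' W.subtype W.ker_subtype
  refine ⟨Submodule.span K (Set.range (W.subtype ∘ v)), ?_, ?_⟩
  · rw [Submodule.span_le]
    rintro _ ⟨i, rfl⟩
    exact (v i).2
  · rw [finrank_span_eq_card hv', Fintype.card_fin]

end LinearSubspaces

/-! ### Dimension of closed subsets via flags of linear subspaces. -/

section Dimension

variable {K : Type*} [Field K] {k : ℕ}

/-- The generic point of the linear subspace of `ℙ^k` defined by a nonzero subspace `W`. -/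
def linearPoint [Infinite K] (W : Submodule K (Fin (k + 1) → K)) (hW : W ≠ ⊥) : ProjSpace K k where
  asHomogeneousIdeal := ⟨vanishingIdeal K (W : Set (Fin (k + 1) → K)),
    vanishingIdeal_isHomogeneous W⟩
  isPrime := vanishingIdeal_isPrime W
  not_irrelevant_le h := by
    obtain ⟨w, hw, hw0⟩ := W.ne_bot_iff.1 hW
    refine hw0 (funext fun i => ?_)
    have h1 : (X i : MvPolynomial (Fin (k + 1)) K) ∈
        HomogeneousIdeal.irrelevant (homogeneousSubmodule (Fin (k + 1)) K) :=
      HomogeneousIdeal.mem_irrelevant_of_mem _ zero_lt_one (isHomogeneous_X K i)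
    simpa using h h1 w hw

lemma linearPoint_le_iff [Infinite K] {W W' : Submodule K (Fin (k + 1) → K)} (hW : W ≠ ⊥) (hW' : W' ≠ ⊥) :
    linearPoint W hW ≤ linearPoint W' hW' ↔ W' ≤ W :=
  vanishingIdeal_le_iff

lemma linearPoint_mem_zeroLocus [Infinite K] {W : Submodule K (Fin (k + 1) → K)} (hW : W ≠ ⊥)
    {I : Ideal (MvPolynomial (Fin (k + 1)) K)} :
    linearPoint W hW ∈ ProjectiveSpectrum.zeroLocus (homogeneousSubmodule (Fin (k + 1)) K) I ↔
      ∀ f ∈ I, ∀ w ∈ W, eval w f = 0 :=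
  Iff.rfl

/-- The closure of a point, as an irreducible closed subset. -/
def pointClosure {T : Type*} [TopologicalSpace T] (x : T) :
    TopologicalSpace.IrreducibleCloseds T :=
  ⟨closure {x}, isIrreducible_singleton.closure, isClosed_closure⟩

lemma pointClosure_le_iff {Z : Set (ProjSpace K k)} {x y : Z} :
    pointClosure x ≤ pointClosure y ↔ y.1 ≤ x.1 := by
  rw [ProjectiveSpectrum.le_iff_mem_closure]
  have h1 : pointClosure x ≤ pointClosure y ↔ closure {x} ⊆ closure {y} := Iff.rfl
  rw [h1, isClosed_closure.closure_subset_iff, Set.singleton_subset_iff, closure_subtype,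
    Set.image_singleton]

/-- A full flag of subspaces of W gives a strict chain of irreducible closed subsets of Z. -/
lemma le_height_pointClosure [Infinite K] {Z : Set (ProjSpace K k)} {I : Ideal (MvPolynomial (Fin (k + 1)) K)}
    (hZ : Z = ProjectiveSpectrum.zeroLocus (homogeneousSubmodule (Fin (k + 1)) K) I)
    {m : ℕ} {W : Submodule K (Fin (k + 1) → K)} (hW : W ≠ ⊥) (hm : Module.finrank K W = m + 1)
    (hWZ : linearPoint W hW ∈ Z) :
    (m : ℕ∞) ≤ Order.height (pointClosure (⟨linearPoint W hW, hWZ⟩ : Z)) := by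
  induction m generalizing W with
  | zero => simp
  | succ m ih =>
    obtain ⟨W', hle, hW'⟩ := exists_le_finrank_eq W (m := m + 1) (by omega)
    have hne : W' ≠ ⊥ := by
      rintro rfl
      simp at hW'
    have hmem : linearPoint W' hne ∈ Z := by
      rw [hZ, linearPoint_mem_zeroLocus] at hWZ ⊢
      exact fun f hf w hw => hWZ f hf w (hle hw)
    have hlt : pointClosure (⟨linearPoint W' hne, hmem⟩ : Z) <
        pointClosure (⟨linearPoint W hW, hWZ⟩ : Z) := by
      rw [lt_iff_le_not_ge, pointClosure_le_iff, pointClosure_le_iff, linearPoint_le_iff,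
        linearPoint_le_iff]
      refine ⟨hle, fun hge => ?_⟩
      have := le_antisymm hle hge
      subst this
      omega
    refine le_trans ?_ (Order.height_add_one_le hlt)
    push_cast
    gcongr
    exact ih hne hW' hmem

/-- A linear subspace of dimension at least `dim Z` in an irreducible closed subset `Z` of `ℙ^k`
contains `Z`. -/
lemma linearPoint_le_of_finrank [Infinite K] {Z : Set (ProjSpace K k)}
    {I : Ideal (MvPolynomial (Fin (k + 1)) K)}
    (hZ : Z = ProjectiveSpectrum.zeroLocus (homogeneousSubmodule (Fin (k + 1)) K) I)
    (hirr : IsIrreducible Z) {d : ℕ} (hd : topologicalKrullDim Z ≤ d)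
    {W : Submodule K (Fin (k + 1) → K)} (hW : W ≠ ⊥) (hm : d + 1 ≤ Module.finrank K W)
    (hWZ : linearPoint W hW ∈ Z) {x : ProjSpace K k} (hx : x ∈ Z) : linearPoint W hW ≤ x := by
  have : IrreducibleSpace Z := (irreducibleSpace_def _).2 (by
    have := (Subtype.preirreducibleSpace hirr.isPreirreducible)
    have := hirr.nonempty.to_subtype
    exact (⟨inferInstance⟩ : IrreducibleSpace Z).isIrreducible_univ)
  let T : TopologicalSpace.IrreducibleCloseds Z :=
    ⟨Set.univ, IrreducibleSpace.isIrreducible_univ Z, isClosed_univ⟩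
  have hT : ∀ S, S ≤ T := fun _ x _ => Set.mem_univ x
  obtain ⟨m, hm'⟩ : ∃ m, Module.finrank K W = m + 1 := ⟨_, (Nat.succ_pred (by omega)).symm⟩
  have h1 := le_height_pointClosure hZ hW hm' hWZ
  -- If the linear subspace missed a point of Z, then Z itself would extend its flag to a chain of
  -- length m + 1 > d.
  by_contra hnot
  have hlt : pointClosure (⟨linearPoint W hW, hWZ⟩ : Z) < T := by
    refine lt_of_le_not_ge (hT _) fun hge => hnot ?_
    have hle : pointClosure (⟨x, hx⟩ : Z) ≤ pointClosure (⟨linearPoint W hW, hWZ⟩ : Z) :=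
      (hT _).trans hge
    exact pointClosure_le_iff.1 hle
  have h2 := (add_le_add_left h1 1).trans (Order.height_add_one_le hlt)
  have h3 := (WithBot.coe_le_coe.2 h2).trans ((Order.height_le_krullDim T).trans hd)
  have h4 : ((m + 1 : ℕ) : WithBot ℕ∞) ≤ (d : ℕ) := by exact_mod_cast h3
  have h5 : m + 1 ≤ d := by exact_mod_cast h4
  omega

/-- The Krull dimension of a closed subset of `ℙ^k` is at least that of its linear subspaces. -/
lemma finrank_le_topologicalKrullDim [Infinite K] {Z : Set (ProjSpace K k)}
    {I : Ideal (MvPolynomial (Fin (k + 1)) K)}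
    (hZ : Z = ProjectiveSpectrum.zeroLocus (homogeneousSubmodule (Fin (k + 1)) K) I)
    {m : ℕ} {W : Submodule K (Fin (k + 1) → K)} (hW : W ≠ ⊥) (hm : Module.finrank K W = m + 1)
    (hWZ : linearPoint W hW ∈ Z) : (m : WithBot ℕ∞) ≤ topologicalKrullDim Z := by
  have h1 := WithBot.coe_le_coe.2 (le_height_pointClosure hZ hW hm hWZ)
  exact_mod_cast h1.trans (Order.height_le_krullDim _)

end Dimension

/-! ### Singular points from vanishing to order two. -/

section Singular

variable {K : Type*} [Field K] {k : ℕ}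

/-- A nonzero element of I is a nonzerodivisor, so passing to the quotient lowers the dimension k +
1 by at least one. -/
lemma coneLocalDim_lt {I : Ideal (MvPolynomial (Fin (k + 1)) K)} (hI : I ≠ ⊥)
    {v : Fin (k + 1) → K} (hv : ∀ f ∈ I, eval v f = 0) : coneLocalDim I v < (k + 1 : ℕ) := by
  obtain ⟨r, hrI, hr⟩ := Submodule.exists_mem_ne_zero_of_ne_bot hI
  have hne : (RingHom.ker (eval v)).map (Ideal.Quotient.mk I) ≠ ⊤ := by
    intro h
    have h1 := congrArg (Ideal.comap (Ideal.Quotient.mk I)) h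
    rw [Ideal.comap_map_of_surjective _ Ideal.Quotient.mk_surjective, Ideal.comap_top,
      ← RingHom.ker_eq_comap_bot, Ideal.mk_ker, sup_eq_left.2 (fun f hf => hv f hf)] at h1
    exact RingHom.ker_ne_top (eval v) h1
  have h1 := Ideal.height_le_ringKrullDim_of_ne_top hne
  have h2 : ringKrullDim (MvPolynomial (Fin (k + 1)) K ⧸ I) ≤
      ringKrullDim (MvPolynomial (Fin (k + 1)) K ⧸ Ideal.span {r}) :=
    ringKrullDim_le_of_surjective _ (Ideal.Quotient.factor_surjective
      ((Ideal.span_singleton_le_iff_mem I).2 hrI))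
  have h3 := ringKrullDim_quotient_succ_le_of_nonZeroDivisor (mem_nonZeroDivisors_of_ne_zero hr)
  have h4 : ringKrullDim (MvPolynomial (Fin (k + 1)) K) = ((k + 1 : ℕ) : WithBot ℕ∞) := by
    simp
  have h5 : ((coneLocalDim I v : ℕ∞) : WithBot ℕ∞) + 1 ≤ ((k + 1 : ℕ) : WithBot ℕ∞) := by
    rw [← h4]
    refine le_trans ?_ h3
    gcongr
    exact h1.trans h2
  have h6 : coneLocalDim I v + 1 ≤ ((k + 1 : ℕ) : ℕ∞) := by exact_mod_cast h5
  refine lt_of_lt_of_le ?_ h6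
  refine (ENat.lt_add_one_iff ?_).2 le_rfl
  intro htop
  rw [htop] at h6
  simp at h6

/-- A point at which all elements of a nonzero ideal vanish to order at least two is singular. -/
lemma isSingularPoint_of_le_sq {I : Ideal (MvPolynomial (Fin (k + 1)) K)} (hI : I ≠ ⊥)
    {v : Fin (k + 1) → K} (hv0 : v ≠ 0) (hv : I ≤ RingHom.ker (eval v) ^ 2) :
    IsSingularPoint I v := by
  have hzero : ∀ f ∈ I, eval v f = 0 := fun f hf => Ideal.pow_le_self two_ne_zero (hv hf)
  refine ⟨hv0, hzero, ?_⟩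
  have hgrad : ∀ f ∈ RingHom.ker (eval v) ^ 2, ∀ i, eval v (pderiv i f) = 0 := by
    intro f hf i
    rw [pow_two] at hf
    induction hf using Submodule.mul_induction_on' with
    | mem_mul_mem a ha b hb =>
      rw [RingHom.mem_ker] at ha hb
      simp [Derivation.leibniz, ha, hb]
    | add a _ b _ ha hb => simp [ha, hb]
  have hjac : jacobianRank I v = 0 := by
    have : {w : Fin (k + 1) → K | ∃ f ∈ I, w = fun i => eval v (pderiv i f)} ⊆ {0} := by
      rintro w ⟨f, hf, rfl⟩
      exact funext fun i => hgrad f (hv hf) i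
    rw [jacobianRank, Submodule.span_eq_bot.2 fun w hw => this hw]
    simp
  rw [hjac, Nat.cast_zero, zero_add]
  exact coneLocalDim_lt hI hzero

end Singular

/-! ### Centers of the projections inside the critical locus. -/

section Centers

variable {K : Type*} [Field K] {k n : ℕ} {h : Fin n → ℕ}

/-- The subspace whose projectivization is the center of the projection `A`. -/
def center {m : ℕ} (A : Matrix (Fin (m + 1)) (Fin (k + 1)) K) : Submodule K (Fin (k + 1) → K) :=
  LinearMap.ker A.mulVecLin

lemma eval_linearForms {m : ℕ} (A : Matrix (Fin (m + 1)) (Fin (k + 1)) K) (r : Fin (m + 1))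
    (v : Fin (k + 1) → K) : eval v (linearForms A r) = A.mulVec v r := by
  simp [linearForms, Matrix.mulVec, dotProduct]

lemma le_finrank_center {m : ℕ} (A : Matrix (Fin (m + 1)) (Fin (k + 1)) K) :
    k + 1 ≤ Module.finrank K (center A) + (m + 1) := by
  have h1 := LinearMap.finrank_range_add_finrank_ker A.mulVecLin
  have h2 := Submodule.finrank_le (LinearMap.range A.mulVecLin)
  simp only [Module.finrank_fin_fun] at h1 h2
  rw [center]
  omega

lemma le_finrank_center_inf {m m' : ℕ} (A : Matrix (Fin (m + 1)) (Fin (k + 1)) K)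
    (B : Matrix (Fin (m' + 1)) (Fin (k + 1)) K) :
    k + 1 ≤ Module.finrank K (center A ⊓ center B : Submodule K (Fin (k + 1) → K)) +
      (m + m' + 2) := by
  have h1 := Submodule.finrank_sup_add_finrank_inf_eq (center A) (center B)
  have h2 := Submodule.finrank_le (center A ⊔ center B)
  have h3 := le_finrank_center A
  have h4 := le_finrank_center B
  simp only [Module.finrank_fin_fun] at h2
  omega

variable (P Q : ∀ j, Matrix (Fin (h j + 1)) (Fin (k + 1)) K)

/-- The entries of the column of `Q_j(X)` vanish on the center of `Q_j`. -/
lemma eval_grassmannMatrix {α : Fin n → ℕ} (S' : ∀ j, Matrix (Fin (h j + 1)) (Fin (h j - α j)) K)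
    {j : Fin n} {v : Fin (k + 1) → K} (hv : v ∈ center (Q j)) (r : Σ j, Fin (h j + 1)) :
    eval v (grassmannMatrix (fun j => (P j).map C) (fun j => spanningMatrix (Q j) (S' j)) r
      (Sum.inr ⟨j, 0⟩)) = 0 := by
  obtain ⟨i, r⟩ := r
  rw [grassmannMatrix, Matrix.fromCols_apply_inr, Matrix.blockDiagonal'_apply]
  split_ifs with hij
  · dsimp at hij
    subst hij
    have : (Q i).mulVec v r = 0 := congrFun (LinearMap.mem_ker.1 hv) r
    simpa [spanningMatrix, eval_linearForms] using this
  · simp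

lemma eval_criticalIdeal {j : Fin n} {v : Fin (k + 1) → K} (hv : v ∈ center (Q j)) :
    ∀ f ∈ criticalIdeal P Q, eval v f = 0 := by
  suffices criticalIdeal P Q ≤ RingHom.ker (eval v) from fun f hf => this hf
  rw [criticalIdeal, Ideal.span_le]
  rintro f ⟨α, -, -, S', e, rfl⟩
  rw [SetLike.mem_coe, RingHom.mem_ker, RingHom.map_det]
  refine Matrix.det_eq_zero_of_column_eq_zero (e.symm (Sum.inr ⟨j, 0⟩)) fun r => ?_
  simpa using eval_grassmannMatrix P Q S' hv r

lemma criticalIdeal_le_sq {i j : Fin n} (hij : i ≠ j) {v : Fin (k + 1) → K}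
    (hi : v ∈ center (Q i)) (hj : v ∈ center (Q j)) :
    criticalIdeal P Q ≤ RingHom.ker (eval v) ^ 2 := by
  rw [criticalIdeal, Ideal.span_le]
  rintro f ⟨α, -, -, S', e, rfl⟩
  rw [SetLike.mem_coe, Matrix.det_apply]
  refine Ideal.sum_mem _ fun τ _ => ?_
  rw [Units.smul_def, zsmul_eq_mul]
  refine Ideal.mul_mem_left _ _ ?_
  -- Each term of the Leibniz expansion has one factor from each of these two distinct columns, and
  -- both factors vanish at v.
  have hne : e.symm (Sum.inr ⟨i, 0⟩) ≠ e.symm (Sum.inr ⟨j, 0⟩) := by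
    simp [hij]
  rw [← Finset.mul_prod_erase _ _ (Finset.mem_univ (e.symm (Sum.inr ⟨i, 0⟩))),
    ← Finset.mul_prod_erase _ _ (Finset.mem_erase.2 ⟨hne.symm, Finset.mem_univ _⟩), ← mul_assoc,
    pow_two]
  refine Ideal.mul_mem_right _ _ (Ideal.mul_mem_mul ?_ ?_)
  · simpa using eval_grassmannMatrix P Q S' hi _
  · simpa using eval_grassmannMatrix P Q S' hj _

lemma linearPoint_center_mem [Infinite K] {j : Fin n} {W : Submodule K (Fin (k + 1) → K)}
    (hW : W ≠ ⊥) (hWj : W ≤ center (Q j)) : linearPoint W hW ∈ criticalLocus P Q :=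
  linearPoint_mem_zeroLocus hW |>.2 fun f hf _ hw => eval_criticalIdeal P Q (hWj hw) f hf

end Centers

end CriticalLocus
end

/-- The indices 0, 1 and 2, 3 form two disjoint pairs. -/
lemma sum_ge_of_pairwise_add_ge {n : ℕ} (hn : 4 ≤ n) (h : Fin n → ℕ) {a : ℕ}
    (ha : ∀ i j, i ≠ j → a ≤ h i + h j) : 2 * a ≤ ∑ j, h j := by
  obtain ⟨m, rfl⟩ := Nat.exists_eq_add_of_le' hn
  simp only [Fin.sum_univ_succ]
  have h1 := ha 0 (Fin.succ 0) (Fin.succ_ne_zero _).symm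
  have h2 := ha (Fin.succ (Fin.succ 0)) (Fin.succ (Fin.succ (Fin.succ 0)))
    (by rw [Ne, Fin.succ_inj, Fin.succ_inj]; exact (Fin.succ_ne_zero _).symm)
  omega

theorem theorem4p3 {K : Type*} [Field K] [IsAlgClosed K] {k n c : ℕ} (hn : 4 ≤ n) (hc : 2 ≤ c)
    (h : Fin n → ℕ) (P Q : ∀ j, Matrix (Fin (h j + 1)) (Fin (k + 1)) K)
    (hP : ∀ j, CriticalLocus.IsProjection (P j)) (hQ : ∀ j, CriticalLocus.IsProjection (Q j))
    (hexp : ∑ j, h j = k + c)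
    (hcodim : topologicalKrullDim (CriticalLocus.criticalLocus P Q) + (c : WithBot ℕ∞) = k) :
    ¬ IsIrreducible (CriticalLocus.criticalLocus P Q) ∨
      ∃ v, CriticalLocus.IsSingularPoint (CriticalLocus.criticalIdeal P Q) v := by
  open CriticalLocus in
  have : Infinite K := IsAlgClosed.instInfinite
  rw [or_iff_not_imp_left, not_not]
  intro hirr
  by_contra! hsing
  obtain ⟨d, hd, hdc⟩ : ∃ d : ℕ, topologicalKrullDim (criticalLocus P Q) = d ∧ d + c = k := by
    generalize topologicalKrullDim (criticalLocus P Q) = D at hcodim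
    induction D using WithBot.recBotCoe with
    | bot => simp at hcodim
    | coe D =>
      have hD : D + c = k := by exact_mod_cast hcodim
      induction D using ENat.recTopCoe with
      | top => simp at hD
      | coe d => exact ⟨d, rfl, by exact_mod_cast hD⟩
  -- Otherwise the locus is all of ℙ^k, of dimension at least k > d.
  have hI : criticalIdeal P Q ≠ ⊥ := by
    intro hI
    have h1 := finrank_le_topologicalKrullDim (Z := criticalLocus P Q) rfl
      (W := ⊤) (m := k) top_ne_bot (by simp)
      ((linearPoint_mem_zeroLocus _).2 fun f hf w _ => by
        rw [hI, Ideal.mem_bot] at hf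
        simp [hf])
    rw [hd] at h1
    have h2 : k ≤ d := by exact_mod_cast h1
    omega
  have hdisj : ∀ i j, i ≠ j → center (Q i) ⊓ center (Q j) = ⊥ := by
    intro i j hij
    by_contra hne
    obtain ⟨v, hv, hv0⟩ := Submodule.exists_mem_ne_zero_of_ne_bot hne
    exact hsing v (isSingularPoint_of_le_sq hI hv0 (criticalIdeal_le_sq P Q hij hv.1 hv.2))
  have hpair : ∀ i j, i ≠ j → k - 1 ≤ h i + h j := by
    intro i j hij
    have h1 := le_finrank_center_inf (Q i) (Q j)
    rw [hdisj i j hij, finrank_bot] at h1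
    omega
  have hge : ∀ j, c ≤ h j := by
    intro j
    by_contra! hj
    have hrank : d + 1 ≤ Module.finrank K (center (Q j)) := by
      have := le_finrank_center (Q j)
      omega
    have hjne : center (Q j) ≠ ⊥ := fun h0 => by
      rw [h0, finrank_bot] at hrank
      omega
    -- The center of `Q j` fills the locus, so a nonempty center of `Q i` would lie inside it,
    -- against disjointness.
    have hbig : ∀ i, i ≠ j → k ≤ h i := by
      intro i hij
      by_contra! hi
      have hine : center (Q i) ≠ ⊥ := fun h0 => by
        have := le_finrank_center (Q i)
        rw [h0, finrank_bot] at this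
        omega
      have hle := linearPoint_le_of_finrank (Z := criticalLocus P Q) rfl hirr hd.le hjne hrank
        (linearPoint_center_mem P Q hjne le_rfl) (linearPoint_center_mem P Q hine le_rfl)
      rw [linearPoint_le_iff] at hle
      exact hine (by rw [← hdisj i j hij, inf_eq_left.2 hle])
    have h1 : ∑ i ∈ Finset.univ.erase j, h i ≤ ∑ i, h i :=
      Finset.sum_le_sum_of_subset (Finset.erase_subset _ _)
    have h2 := Finset.card_nsmul_le_sum (Finset.univ.erase j) h k
      fun i hi => hbig i (Finset.ne_of_mem_erase hi)
    rw [Finset.card_erase_of_mem (Finset.mem_univ j), Finset.card_univ, Fintype.card_fin,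
      smul_eq_mul] at h2
    -- Thus 3k ≤ k + c, impossible since 2 ≤ c ≤ k.
    have h3 : 3 * k ≤ (n - 1) * k := Nat.mul_le_mul_right k (by omega)
    have h4 := h3.trans (h2.trans h1)
    omega
  have h1 := sum_ge_of_pairwise_add_ge hn h hpair
  have h2 := sum_ge_of_pairwise_add_ge hn h (a := 2 * c) fun i j _ => by
    have := hge i
    have := hge j
    omega
  omega
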